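/- Let $m,t,l$ be positive integers with $2^m-1=tl$, let $\alpha$ be a primitive element of $\mathbb F_{2^m}$, let $A=a^t$ for some $a\in\mathbb F_{2^m}\setminus\{0\}$, and put $G(z)=z^t+A\in\mathbb F_{2^m}[z]$, $\mathcal N=\{x\in\mathbb F_{2^m}:G(x)\neq 0\}$ and $S=\sum_{\mu=1}^{l-1}\frac1{\alpha^{\mu t}+1}$. Let $\Gamma(\mathcal N,G)$ be the binary Goppa code consisting of all $(c_x)_{x\in\mathcal N}\in\mathbb F_2^{\mathcal N}$ with $\sum_{x\in\mathcal N}\frac{c_x}{z-x}\equiv 0 \pmod{G(z)}$. For a binary linear code $C$ of length $n$ containing the all-ones vector $\mathbf 1$, let $Q(C)\subseteq(\mathbb C^2)^{\otimes n}$ be the CSS code of the pair $C_1=C$, $C_2=\{0,\mathbf 1\}^\perp$, that is, the span of the states $\sum_{y\in C_1^\perp}|x+y\rangle$ with $x\in C_2$. A pure $[[n,k,d_z/d_x]]$ asymmetric quantum code (AQC) is a subspace $Q\subseteq(\mathbb C^2)^{\otimes n}$ of dimension $2^k$, with orthogonal projection $P$, such that $PEP=0$ for every nontrivial Pauli error $E$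 whose $X$-part acts on fewer than $d_x$ qubits and whose $Z$-part acts on fewer than $d_z$ qubits, and such that $d_z$ and $d_x$ are largest possible: some $Z$-error on exactly $d_z$ qubits and some $X$-error on exactly $d_x$ qubits are not detected (that is, $PEP\notin\mathbb C P$) if $k\ge 1$, and satisfy $PEP\ne0$ if $k=0$. Then $S\in\{0,1\}$, and the following hold. (1) If $S=1$, then $\Gamma(\mathcal N,G)$ contains $\mathbf 1$, and $Q(\Gamma(\mathcal N,G))$ is a pure AQC with parameters $$[[2^m-t,\ \ge 2^m-t-mt-1,\ (2t+1)/2]].$$ Extending $\Gamma(\mathcal N,G)$ by an overall parity check gives in the same way a pure AQC with parameters $$[[2^m-t+1,\ \ge 2^m-t-mt-1,\ (2t+2)/2]],$$ and puncturing $\Gamma(\mathcal N,G)$ at any one coordinate gives a pure AQC with parameters $$[[2^m-t-1,\ \ge 2^m-t-mt-1,\ 2t/2]].$$ (2) If $S=0$ and $l>1$ (so that $\mathcal N\setminus\{0\}\ne\emptyset$), then puncturing $\Gamma(\mathcal N,G)$ at the coordinate $0\in\mathcal N$ gives in the same way a code with location set $\mathcal N\setminus\{0\}$ and a pure AQC with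 parameters $$[[2^m-t-1,\ \ge 2^m-t-mt-1,\ \ge 2t/2]].$$ Here "$\ge$" in the second and third places means that the exact value is at least the given number; the other parameters are exact. -/

import Mathlib

open Polynomial
open scoped InnerProductSpace

/-! ### Classical linear codes, with coordinates indexed by a finite type -/

/-- The dual code `C^⊥` with respect to the standard bilinear form. -/
def dualCode {K ι : Type*} [Field K] [Fintype ι] (C : Submodule K (ι → K)) :
    Submodule K (ι → K) where
  carrier := {v | ∀ c ∈ C, c ⬝ᵥ v = 0}
  zero_mem' := by intro c _; simp
  add_mem' := by
    intro v w hv hw c hc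
    rw [dotProduct_add, hv c hc, hw c hc, add_zero]
  smul_mem' := by
    intro r v hv c hc
    rw [dotProduct_smul, hv c hc, smul_zero]

/-- The code obtained from `C` by deleting the coordinate `p` of every codeword. -/
def punctureCode {K ι : Type*} [Field K] (C : Submodule K (ι → K)) (p : ι) :
    Submodule K ({i : ι // i ≠ p} → K) :=
  C.map (LinearMap.funLeft K K (Subtype.val : {i : ι // i ≠ p} → ι))

/-- The code obtained from `C` by appending (at `none`) an overall parity check coordinate. -/
def extendCode {K ι : Type*} [Field K] [Fintype ι] (C : Submodule K (ι → K)) :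
    Submodule K (Option ι → K) where
  carrier := {v | (fun i : ι => v (some i)) ∈ C ∧ ∑ j : Option ι, v j = 0}
  zero_mem' := ⟨C.zero_mem, by simp⟩
  add_mem' := by
    intro v w hv hw
    refine ⟨C.add_mem hv.1 hw.1, ?_⟩
    simp only [Pi.add_apply, Finset.sum_add_distrib, hv.2, hw.2, add_zero]
  smul_mem' := by
    intro r v hv
    refine ⟨C.smul_mem r hv.1, ?_⟩
    simp only [Pi.smul_apply, ← Finset.smul_sum, hv.2, smul_zero]

/-- The set of all elements of `F` that are not roots of `G`, as a type. -/
abbrev NonRoots {F : Type*} [Field F] (G : F[X]) : Type _ := {x : F // G.eval x ≠ 0}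

/-- The Goppa code `Γ(L, G)` over `K`, for `K ⊆ F`, with Goppa polynomial `G` over `F` and location
set `L = {a i}` (distinct elements of `F` that are not roots of `G`): the vectors `c` over `K` with
`∑ i, c i / (z - a i) ≡ 0 mod G(z)`. The equation is read in `F[z]/(G)`, where `z - a i` is
a unit because `G(a i) ≠ 0`. -/
noncomputable def goppaCode (K : Type*) {F ι : Type*} [Field K] [Field F] [Algebra K F] [Fintype ι]
    (G : F[X]) (a : ι → F) : Submodule K (ι → K) where
  carrier := {c | ∑ i, AdjoinRoot.of G (algebraMap K F (c i)) *
      Ring.inverse (AdjoinRoot.mk G (X - C (a i))) = 0}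
  zero_mem' := by simp
  add_mem' := by
    intro v w hv hw
    change _ = _ at hv hw
    change ∑ i, _ = _
    simp only [Pi.add_apply, map_add, add_mul, Finset.sum_add_distrib, hv, hw, add_zero]
  smul_mem' := by
    intro r v hv
    change _ = _ at hv
    change ∑ i, _ = _
    simp only [Pi.smul_apply, smul_eq_mul, map_mul, mul_assoc, ← Finset.mul_sum, hv, mul_zero]

/-! ### Binary quantum codes -/

/-- The state space `(ℂ²)^{⊗n} = ℂ^{2^n}` of the qubits indexed by `ι`, with the computational basis
`|v⟩`, `v ∈ 𝔽₂^ι`. -/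
abbrev QState (ι : Type*) [Fintype ι] [DecidableEq ι] : Type _ :=
  EuclideanSpace ℂ (ι → ZMod 2)

section Quantum

variable {ι : Type*} [Fintype ι] [DecidableEq ι]

/-- The `X`-error `X_a : |v⟩ ↦ |v + a⟩`, acting on the qubits in the support of `a`. -/
noncomputable def errX (a : ι → ZMod 2) : QState ι →ₗ[ℂ] QState ι where
  toFun ψ := WithLp.toLp 2 (fun v => ψ (v - a))
  map_add' _ _ := rfl
  map_smul' _ _ := rfl

/-- The `Z`-error `Z_b : |v⟩ ↦ (-1)^{b ⬝ v} |v⟩`, acting on the qubits in the support of `b`. -/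
noncomputable def errZ (b : ι → ZMod 2) : QState ι →ₗ[ℂ] QState ι where
  toFun ψ := WithLp.toLp 2 (fun v => (-1 : ℂ) ^ (b ⬝ᵥ v).val * ψ v)
  map_add' ψ φ := by ext v; simp [mul_add]
  map_smul' r ψ := by ext v; simp [mul_left_comm]

/-- The quantum code `Q` detects the error `E` (Knill--Laflamme condition: `P E P = c P`, where `P`
is the orthogonal projection onto `Q`). -/
def Detects (Q : Submodule ℂ (QState ι)) (E : QState ι →ₗ[ℂ] QState ι) : Prop :=
  ∃ c : ℂ, ∀ u ∈ Q, ∀ v ∈ Q, ⟪u, E v⟫_ℂ = c * ⟪u, v⟫_ℂ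

/-- The quantum code `Q` purely detects the error `E`: `P E P = 0`, i.e. `E` maps `Q` to a subspace
orthogonal to `Q`. -/
def PurelyDetects (Q : Submodule ℂ (QState ι)) (E : QState ι →ₗ[ℂ] QState ι) : Prop :=
  ∀ u ∈ Q, ∀ v ∈ Q, ⟪u, E v⟫_ℂ = 0

/-- `Q` is a pure binary asymmetric quantum code with parameters `[[n, k, dz/dx]]`: it has length
`n` and dimension `2^k`; every nontrivial error consisting of an `X`-error on at most `dx - 1`
qubits and a `Z`-error on at most `dz - 1` qubits is (purely) detected; and neither `dz` nor `dx`
can be enlarged. For `k ≥ 1` the last clause says that some `Z`-error on `dz` qubits and some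
`X`-error on `dx` qubits go undetected. A code of dimension one detects everything, and its
distances are, as usual, the least weights of errors that are not purely detected. -/
structure IsPureAQC (Q : Submodule ℂ (QState ι)) (n k dz dx : ℕ) : Prop where
  length_eq : Fintype.card ι = n
  dim_eq : Module.finrank ℂ Q = 2 ^ k
  detects : ∀ a b : ι → ZMod 2, (a ≠ 0 ∨ b ≠ 0) → hammingNorm a < dx → hammingNorm b < dz →
    PurelyDetects Q (errX a ∘ₗ errZ b)
  dz_max : ∃ b : ι → ZMod 2, hammingNorm b = dz ∧ ¬ PurelyDetects Q (errZ b) ∧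
    (1 ≤ k → ¬ Detects Q (errZ b))
  dx_max : ∃ a : ι → ZMod 2, hammingNorm a = dx ∧ ¬ PurelyDetects Q (errX a) ∧
    (1 ≤ k → ¬ Detects Q (errX a))

open Classical in
/-- The (unnormalised) coset state `∑_{y ∈ D} |x + y⟩`. -/
noncomputable def cosetState (D : Submodule (ZMod 2) (ι → ZMod 2)) (x : ι → ZMod 2) : QState ι :=
  WithLp.toLp 2 (fun v => if v - x ∈ D then 1 else 0)

/-- The CSS quantum code of binary linear codes `C₁`, `C₂` with `C₂^⊥ ⊆ C₁`: the span of the states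
`∑_{y ∈ C₁^⊥} |x + y⟩`, `x ∈ C₂`. (Here `C₁` is responsible for the `Z`-errors and `C₂` for the
`X`-errors.) -/
noncomputable def cssCode (C₁ C₂ : Submodule (ZMod 2) (ι → ZMod 2)) : Submodule ℂ (QState ι) :=
  Submodule.span ℂ (cosetState (dualCode C₁) '' (C₂ : Set (ι → ZMod 2)))

/-- The CSS quantum code of a binary linear code `C₁` that contains the all-ones vector, with `C₂`
the dual of the code `{0, 1}` generated by the all-ones vector. -/
noncomputable def cssWithOnes (C₁ : Submodule (ZMod 2) (ι → ZMod 2)) : Submodule ℂ (QState ι) :=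
  cssCode C₁ (dualCode (Submodule.span (ZMod 2) {fun _ => (1 : ZMod 2)}))

end Quantum

/-! Quantum side (`isPureAQC_cssWithOnes`). Let `C` contain the all-ones vector and put `D = C^⊥`. A
`Z`-error `b` outside `D^⊥ = C` averages to zero on every coset of `D`, and one inside `C` acts on
each coset state by a sign. The states used are indexed by even-weight vectors, so an `X`-error of
weight one leaves the code, while some `X`-error of weight two does not. Hence `dx = 2`, `dz` is the
minimum distance of `C`, and `k = dim C - 1`.

Classical side. `G` has `t` distinct roots `r` in `F`, so a word with support `T` is a codeword iff
`∑ x ∈ T, 1/(r - x) = 0` at each `r`. This sum is `f'(r)/f(r)` for `f = ∏ (X - x)`. In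
characteristic two `f'' = 0`, so each `r` is a double root of `f'`, and `2t + 1 ≤ |T|`
(`two_mul_card_lt_card`).

Summing over a fibre `x^t = a^t η` with `η ≠ 0, 1` gives `r⁻¹/(η + 1)` (`sum_inv_sub_powFiber_mul`).
Since `1/(η + 1) + 1/(η⁻¹ + 1) = 1`, the point `0` with the fibres of `η` and `η⁻¹` supports a
codeword of weight `2t + 1` (`exists_support_card_eq`). All nonzero locations together give `r⁻¹ S`,
and `S² = S`. If `S = 1`, adding `0` makes the all-ones word a codeword; if `S = 0`, the word that
is one exactly off `0` is a codeword. -/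

theorem mem_dualCode {K ι : Type*} [Field K] [Fintype ι] {C : Submodule K (ι → K)} {v : ι → K} :
    v ∈ dualCode C ↔ ∀ c ∈ C, c ⬝ᵥ v = 0 := Iff.rfl

/-! ### Duality of linear codes. -/

section Dual

variable {K ι : Type*} [Field K] [Fintype ι]

/-- The standard bilinear form on `K^ι`. -/
def stdForm (K ι : Type*) [Field K] [Fintype ι] : LinearMap.BilinForm K (ι → K) :=
  LinearMap.mk₂ K (fun v w => v ⬝ᵥ w) add_dotProduct smul_dotProduct dotProduct_add
    (fun c v w => dotProduct_smul c v w)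

theorem stdForm_apply (v w : ι → K) : stdForm K ι v w = v ⬝ᵥ w := rfl

theorem stdForm_isRefl : (stdForm K ι).IsRefl := fun v w h => by
  rw [stdForm_apply] at h ⊢
  rw [dotProduct_comm, h]

theorem stdForm_nondegenerate : (stdForm K ι).Nondegenerate := by
  classical
  have key : ∀ v : ι → K, (∀ w, stdForm K ι v w = 0) → v = 0 := fun v h =>
    dotProduct_eq_zero v (by simpa [stdForm_apply] using h)
  exact ⟨key, fun v h => key v fun w => stdForm_isRefl _ _ (h w)⟩

theorem dualCode_eq_orthogonal (C : Submodule K (ι → K)) :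
    dualCode C = (stdForm K ι).orthogonal C := rfl

theorem finrank_dualCode (C : Submodule K (ι → K)) :
    Module.finrank K (dualCode C) = Fintype.card ι - Module.finrank K C := by
  rw [dualCode_eq_orthogonal, LinearMap.BilinForm.finrank_orthogonal stdForm_nondegenerate,
    Module.finrank_fintype_fun_eq_card]

theorem dualCode_dualCode (C : Submodule K (ι → K)) : dualCode (dualCode C) = C := by
  rw [dualCode_eq_orthogonal, dualCode_eq_orthogonal,
    LinearMap.BilinForm.orthogonal_orthogonal stdForm_nondegenerate stdForm_isRefl]

theorem dualCode_anti {C D : Submodule K (ι → K)} (h : C ≤ D) : dualCode D ≤ dualCode C :=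
  fun _ hv c hc => hv c (h hc)

theorem mem_dualCode_span_singleton {u v : ι → K} :
    v ∈ dualCode (Submodule.span K {u}) ↔ u ⬝ᵥ v = 0 := by
  refine ⟨fun h => h u (Submodule.mem_span_singleton_self u), fun h c hc => ?_⟩
  obtain ⟨r, rfl⟩ := Submodule.mem_span_singleton.1 hc
  rw [smul_dotProduct, h, smul_zero]

end Dual

theorem natCard_code_ne_zero {ι : Type*} [Fintype ι]
    (D : Submodule (ZMod 2) (ι → ZMod 2)) :
    (Nat.card D : ℂ) ≠ 0 :=
  Nat.cast_ne_zero.2 Nat.card_pos.ne'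

theorem neg_one_pow_val_add (x y : ZMod 2) :
    (-1 : ℂ) ^ (x + y).val = (-1) ^ x.val * (-1) ^ y.val := by
  rw [ZMod.val_add, ← pow_add]
  exact (neg_one_pow_eq_pow_mod_two _).symm

theorem zmod_two_ne_zero {x : ZMod 2} (h : x ≠ 0) : x = 1 := by
  revert x; decide

theorem neg_one_pow_val_of_ne {x : ZMod 2} (h : x ≠ 0) : (-1 : ℂ) ^ x.val = -1 := by
  rw [zmod_two_ne_zero h]; simp [ZMod.val_one]

/-! ### Coset states, errors acting on them, and the dimension of a CSS code. -/

section Quantum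

variable {ι : Type*} [Fintype ι] [DecidableEq ι]

theorem inner_QState (u v : QState ι) : ⟪u, v⟫_ℂ = ∑ w, v w * (starRingEnd ℂ) (u w) := by
  simp [PiLp.inner_apply]

open Classical in
theorem inner_cosetState_errX_errZ (D : Submodule (ZMod 2) (ι → ZMod 2))
    (x y a b : ι → ZMod 2) :
    ⟪cosetState D x, errX a (errZ b (cosetState D y))⟫_ℂ =
      ∑ w, if w - x ∈ D ∧ w - a - y ∈ D then (-1 : ℂ) ^ (b ⬝ᵥ (w - a)).val else 0 := by
  rw [inner_QState]
  refine Finset.sum_congr rfl fun w _ => ?_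
  have e : errX a (errZ b (cosetState D y)) w =
    (-1 : ℂ) ^ (b ⬝ᵥ (w - a)).val * (if w - a - y ∈ D then 1 else 0) := rfl
  rw [e, cosetState]
  by_cases h1 : w - x ∈ D <;> by_cases h2 : w - a - y ∈ D <;> simp [h1, h2]

/-- An `X`-error moving a coset to a different one makes the coset states orthogonal. -/
theorem inner_cosetState_eq_zero_of_notMem {D : Submodule (ZMod 2) (ι → ZMod 2)}
    {x y a b : ι → ZMod 2} (h : a + y - x ∉ D) :
    ⟪cosetState D x, errX a (errZ b (cosetState D y))⟫_ℂ = 0 := by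
  classical
  rw [inner_cosetState_errX_errZ]
  refine Finset.sum_eq_zero fun w _ => if_neg fun hw => h ?_
  have := D.sub_mem hw.1 hw.2
  rwa [show w - x - (w - a - y) = a + y - x by abel] at this

/-- A `Z`-error outside `D^⊥` makes the coset states of `D` orthogonal. -/
theorem inner_cosetState_errZ_eq_zero {D : Submodule (ZMod 2) (ι → ZMod 2)}
    {x y b : ι → ZMod 2} (h : b ∉ dualCode D) :
    ⟪cosetState D x, errX 0 (errZ b (cosetState D y))⟫_ℂ = 0 := by
  classical
  obtain ⟨d, hd, hdb⟩ : ∃ d ∈ D, d ⬝ᵥ b ≠ 0 := by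
    simpa [mem_dualCode] using h
  rw [inner_cosetState_errX_errZ]
  simp only [sub_zero]
  set f : (ι → ZMod 2) → ℂ := fun w =>
    if w - x ∈ D ∧ w - y ∈ D then (-1 : ℂ) ^ (b ⬝ᵥ w).val else 0 with hf
  -- Translation by `d ∈ D` preserves both cosets, and `d ⬝ b = 1` flips the sign, so the sum equals
  -- its negative.
  have hshift : ∀ w, f (w + d) = - f w := fun w => by
    have e1 : w + d - x ∈ D ↔ w - x ∈ D := by
      rw [show w + d - x = (w - x) + d by abel]; exact D.add_mem_iff_left hd
    have e2 : w + d - y ∈ D ↔ w - y ∈ D := by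
      rw [show w + d - y = (w - y) + d by abel]; exact D.add_mem_iff_left hd
    simp only [hf, e1, e2]
    split_ifs
    · rw [dotProduct_add, neg_one_pow_val_add, dotProduct_comm b d, neg_one_pow_val_of_ne hdb]
      ring
    · simp
  have h1 : ∑ w, f (w + d) = ∑ w, f w := Equiv.sum_comp (Equiv.addRight d) f
  rw [Finset.sum_congr rfl fun w _ => hshift w, Finset.sum_neg_distrib] at h1
  exact self_eq_neg.1 h1.symm

theorem inner_cosetState_errX_self (D : Submodule (ZMod 2) (ι → ZMod 2)) (x a : ι → ZMod 2) :
    ⟪cosetState D (a + x), errX a (errZ 0 (cosetState D x))⟫_ℂ = Nat.card D := by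
  classical
  rw [inner_cosetState_errX_errZ]
  simp only [sub_sub, and_self, zero_dotProduct, ZMod.val_zero, pow_zero, Finset.sum_boole]
  congr 1
  rw [Nat.card_eq_fintype_card, ← Fintype.card_subtype]
  exact Fintype.card_congr ((Equiv.subRight (a + x)).subtypeEquiv fun w => Iff.rfl)

/-- Since `b` annihilates `D`, the sign `(-1)^(b ⬝ w)` is constant on the coset of `x`. -/
theorem inner_cosetState_errZ_self {D : Submodule (ZMod 2) (ι → ZMod 2)} {b : ι → ZMod 2}
    (hb : b ∈ dualCode D) (x : ι → ZMod 2) :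
    ⟪cosetState D x, errX 0 (errZ b (cosetState D x))⟫_ℂ =
      (-1) ^ (b ⬝ᵥ x).val * Nat.card D := by
  classical
  rw [← inner_cosetState_errX_self D x 0, inner_cosetState_errX_errZ, inner_cosetState_errX_errZ,
    Finset.mul_sum]
  refine Finset.sum_congr rfl fun w _ => ?_
  simp only [sub_zero, zero_add, and_self, zero_dotProduct, ZMod.val_zero, pow_zero]
  split_ifs with h
  · have : b ⬝ᵥ w = b ⬝ᵥ x := by
      rw [← sub_eq_zero, ← dotProduct_sub, dotProduct_comm]
      exact hb _ h
    rw [this, mul_one]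
  · simp

theorem errX_zero : (errX 0 : QState ι →ₗ[ℂ] QState ι) = LinearMap.id := by
  ext ψ v; simp [errX]

theorem errZ_zero : (errZ 0 : QState ι →ₗ[ℂ] QState ι) = LinearMap.id := by
  ext ψ v; simp [errZ]

theorem inner_cosetState_self (D : Submodule (ZMod 2) (ι → ZMod 2)) (x : ι → ZMod 2) :
    ⟪cosetState D x, cosetState D x⟫_ℂ = Nat.card D := by
  simpa [errX_zero, errZ_zero] using inner_cosetState_errX_self D x 0

theorem inner_cosetState_of_notMem {D : Submodule (ZMod 2) (ι → ZMod 2)} {x y : ι → ZMod 2}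
    (h : y - x ∉ D) : ⟪cosetState D x, cosetState D y⟫_ℂ = 0 := by
  simpa [errX_zero, errZ_zero] using
    inner_cosetState_eq_zero_of_notMem (a := 0) (b := 0) (by rwa [zero_add] : 0 + y - x ∉ D)

theorem cosetState_eq_of_sub_mem {D : Submodule (ZMod 2) (ι → ZMod 2)} {x y : ι → ZMod 2}
    (h : y - x ∈ D) : cosetState D x = cosetState D y := by
  classical
  ext v
  have : v - x ∈ D ↔ v - y ∈ D := by
    rw [show v - x = (v - y) + (y - x) by abel]; exact D.add_mem_iff_left h
  simp [cosetState, this]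

/-- Pure detection need only be checked on generators of the quantum code. -/
theorem purelyDetects_span {s : Set (QState ι)} {E : QState ι →ₗ[ℂ] QState ι}
    (h : ∀ u ∈ s, ∀ v ∈ s, ⟪u, E v⟫_ℂ = 0) : PurelyDetects (Submodule.span ℂ s) E := by
  intro u hu v hv
  induction hu using Submodule.span_induction with
  | zero => simp
  | add a b _ _ ha hb => rw [inner_add_left, ha, hb, add_zero]
  | smul r a _ ha => rw [inner_smul_left, ha, mul_zero]
  | mem u hu =>
    induction hv using Submodule.span_induction with
    | zero => simp
    | add a b _ _ ha hb => rw [map_add, inner_add_right, ha, hb, add_zero]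
    | smul r a _ ha => rw [map_smul, inner_smul_right, ha, mul_zero]
    | mem v hv => exact h u hu v hv

theorem cosetState_mem_cssCode {C₁ C₂ : Submodule (ZMod 2) (ι → ZMod 2)} {x : ι → ZMod 2}
    (hx : x ∈ C₂) : cosetState (dualCode C₁) x ∈ cssCode C₁ C₂ :=
  Submodule.subset_span ⟨x, hx, rfl⟩

/-- The dimension of a CSS code. -/
theorem finrank_cssCode {C₁ C₂ : Submodule (ZMod 2) (ι → ZMod 2)} (h : dualCode C₁ ≤ C₂) :
    Module.finrank ℂ (cssCode C₁ C₂) =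
      2 ^ (Module.finrank (ZMod 2) C₂ - Module.finrank (ZMod 2) (dualCode C₁)) := by
  classical
  set D := dualCode C₁ with hD
  let D' := D.submoduleOf C₂
  let f : C₂ ⧸ D' → QState ι := Quotient.lift (fun x : C₂ => cosetState D (x : ι → ZMod 2))
    (fun x y hxy => by
      have h' : -x + y ∈ D' := QuotientAddGroup.leftRel_apply.1 hxy
      refine cosetState_eq_of_sub_mem ?_
      have : (y : ι → ZMod 2) - x ∈ D := by
        have := (Submodule.mem_comap.1 h')
        simpa [neg_add_eq_sub] using this
      exact this)
  have hf : ∀ x : C₂, f (Submodule.Quotient.mk x) = cosetState D (x : ι → ZMod 2) := fun _ => rfl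
  -- States of distinct cosets have disjoint supports, hence are orthogonal.
  have hlin : LinearIndependent ℂ f := by
    refine linearIndependent_of_ne_zero_of_inner_eq_zero ?_ ?_
    · intro q hq
      obtain ⟨x, rfl⟩ := Submodule.Quotient.mk_surjective D' q
      have := inner_cosetState_self D (x : ι → ZMod 2)
      rw [← hf, hq, inner_zero_left] at this
      exact natCard_code_ne_zero D this.symm
    · intro q r hqr
      obtain ⟨x, rfl⟩ := Submodule.Quotient.mk_surjective D' q
      obtain ⟨y, rfl⟩ := Submodule.Quotient.mk_surjective D' r
      change ⟪f _, f _⟫_ℂ = 0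
      rw [hf, hf]
      refine inner_cosetState_of_notMem fun hxy => hqr ?_
      exact ((Submodule.Quotient.eq D').2 hxy).symm
  have hrange : Set.range f = cosetState D '' (C₂ : Set (ι → ZMod 2)) := by
    ext ψ
    constructor
    · rintro ⟨q, rfl⟩
      obtain ⟨x, rfl⟩ := Submodule.Quotient.mk_surjective D' q
      exact ⟨x, x.2, rfl⟩
    · rintro ⟨x, hx, rfl⟩
      exact ⟨Submodule.Quotient.mk ⟨x, hx⟩, rfl⟩
  have : Fintype (C₂ ⧸ D') := Fintype.ofFinite _
  rw [cssCode, ← hrange, finrank_span_eq_card hlin, Module.card_eq_pow_finrank (K := ZMod 2),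
    ZMod.card, Submodule.finrank_quotient, (Submodule.submoduleOfEquivOfLe h).finrank_eq]

end Quantum

/-! ### Quantum parameters from a code containing the all-ones vector. -/

section CSSWithOnes

variable {ι : Type*} [Fintype ι]

/-- A binary vector of full weight is the all-ones vector. -/
theorem eq_one_of_card_le_hammingNorm {b : ι → ZMod 2} (h : Fintype.card ι ≤ hammingNorm b) :
    b = fun _ => 1 := by
  classical
  funext i
  refine zmod_two_ne_zero fun hi => ?_
  have : hammingNorm b < Fintype.card ι := by
    rw [hammingNorm, ← Finset.card_univ]
    refine Finset.card_lt_card (Finset.ssubset_univ_iff.2 fun he => ?_)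
    have hmem := Finset.mem_univ i
    rw [← he, Finset.mem_filter] at hmem
    exact hmem.2 hi
  omega

theorem one_dotProduct_ne_zero_of_hammingNorm_lt_two {a : ι → ZMod 2} (ha : a ≠ 0)
    (h : hammingNorm a < 2) : (fun _ => (1 : ZMod 2)) ⬝ᵥ a ≠ 0 := by
  classical
  have h1 : hammingNorm a = 1 := by
    have := hammingNorm_pos_iff.2 ha
    omega
  obtain ⟨i, hi⟩ := Finset.card_eq_one.1 h1
  have key : ∀ j, j ≠ i → a j = 0 := fun j hj => by
    by_contra hne
    exact hj (Finset.mem_singleton.1 (hi ▸ Finset.mem_filter.2 ⟨Finset.mem_univ j, hne⟩))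
  have hai : a i ≠ 0 :=
    (Finset.mem_filter.1 (hi ▸ Finset.mem_singleton_self i : i ∈ Finset.univ.filter _)).2
  rw [dotProduct, Finset.sum_eq_single i (fun j _ hj => by rw [key j hj, mul_zero])
    (fun h => absurd (Finset.mem_univ i) h), one_mul]
  exact hai

variable [DecidableEq ι]

theorem ones_dotProduct_single_add_single (b : ι → ZMod 2) (i j : ι) :
    b ⬝ᵥ (Pi.single i 1 + Pi.single j 1) = b i + b j := by
  simp [dotProduct_add]

theorem hammingNorm_single_add_single {i j : ι} (h : i ≠ j) :
    hammingNorm (Pi.single i 1 + Pi.single j 1 : ι → ZMod 2) = 2 := by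
  refine Eq.trans (congrArg Finset.card ?_) (Finset.card_pair h)
  ext k
  by_cases h1 : k = i
  · subst h1; simp [h]
  · by_cases h2 : k = j
    · subst h2; simp [h1]
    · simp [h1, h2]

theorem finrank_cssWithOnes {C : Submodule (ZMod 2) (ι → ZMod 2)} (h1 : (fun _ => 1) ∈ C)
    (hn : 0 < Fintype.card ι) :
    Module.finrank ℂ (cssWithOnes C) = 2 ^ (Module.finrank (ZMod 2) C - 1) := by
  have hle : Submodule.span (ZMod 2) {fun _ : ι => (1 : ZMod 2)} ≤ C := by
    rwa [Submodule.span_singleton_le_iff_mem]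
  have hne : (fun _ : ι => (1 : ZMod 2)) ≠ 0 := fun h => by
    obtain ⟨i⟩ := Fintype.card_pos_iff.1 hn
    exact one_ne_zero (congrFun h i)
  have hs := finrank_span_singleton (K := ZMod 2) hne
  have h2 := Submodule.finrank_mono hle
  have h3 := Submodule.finrank_le C
  rw [Module.finrank_fintype_fun_eq_card] at h3
  rw [cssWithOnes, finrank_cssCode (dualCode_anti hle), finrank_dualCode, finrank_dualCode, hs]
  congr 1
  -- The truncated difference `(n - 1) - (n - dim C)` equals `dim C - 1` because `1 ≤ dim C ≤ n`.
  omega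

/-- The parameters of the quantum code from a binary code containing the all-ones vector. -/
theorem isPureAQC_cssWithOnes {C : Submodule (ZMod 2) (ι → ZMod 2)} {n d : ℕ}
    (h1 : (fun _ => 1) ∈ C) (hcard : Fintype.card ι = n) (hn : 2 ≤ n) (hd0 : 0 < d)
    (hd : ∀ c ∈ C, c ≠ 0 → d ≤ hammingNorm c) (hb : ∃ b ∈ C, hammingNorm b = d) :
    IsPureAQC (cssWithOnes C) n (Module.finrank (ZMod 2) C - 1) d 2 := by
  have hle : Submodule.span (ZMod 2) {fun _ : ι => (1 : ZMod 2)} ≤ C := by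
    rwa [Submodule.span_singleton_le_iff_mem]
  have hconst : 1 ≤ Module.finrank (ZMod 2) C - 1 → ∃ c ∈ C, c ≠ 0 ∧ c ≠ fun _ => 1 := by
    intro hk
    by_contra! hc
    have : C ≤ Submodule.span (ZMod 2) {fun _ : ι => (1 : ZMod 2)} := fun c hcC => by
      by_cases h0 : c = 0
      · rw [h0]; exact Submodule.zero_mem _
      · rw [hc c hcC h0]; exact Submodule.mem_span_singleton_self _
    have h2 := (Submodule.finrank_mono this).trans (finrank_span_le_card _)
    simp at h2
    omega
  have hpair : ∀ c : ι → ZMod 2, c ≠ 0 → c ≠ (fun _ => 1) → ∃ i j, i ≠ j ∧ c i + c j ≠ 0 := by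
    intro c h0 h1
    obtain ⟨i, hi⟩ := Function.ne_iff.1 h0
    obtain ⟨j, hj⟩ := Function.ne_iff.1 h1
    have hi1 : c i = 1 := zmod_two_ne_zero hi
    have hj0 : c j = 0 := by
      by_contra h; exact hj (zmod_two_ne_zero h)
    refine ⟨i, j, ?_, by rw [hi1, hj0]; decide⟩
    rintro rfl
    exact hj hi1
  have hC₂ : ∀ i j : ι, (Pi.single i 1 + Pi.single j 1 : ι → ZMod 2) ∈
      dualCode (Submodule.span (ZMod 2) {fun _ : ι => (1 : ZMod 2)}) := fun i j => by
    rw [mem_dualCode_span_singleton, ones_dotProduct_single_add_single]; decide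
  have hmem : ∀ x ∈ dualCode (Submodule.span (ZMod 2) {fun _ : ι => (1 : ZMod 2)}),
      cosetState (dualCode C) x ∈ cssWithOnes C := fun x hx => cosetState_mem_cssCode hx
  have hne := natCard_code_ne_zero (dualCode C)
  refine ⟨hcard, finrank_cssWithOnes h1 (by omega), ?_, ?_, ?_⟩
  · intro a b hab ha hb
    refine purelyDetects_span ?_
    rintro _ ⟨x, hx, rfl⟩ _ ⟨y, hy, rfl⟩
    rw [LinearMap.comp_apply]
    -- A pure `Z`-error has weight below `d`, so lies outside `C`. Otherwise `a` has weight one: `a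
    -- + y - x` is odd, but `C^⊥` has only even words, so the cosets differ whatever `b` is.
    by_cases ha0 : a = 0
    · subst ha0
      refine inner_cosetState_errZ_eq_zero fun hbC => ?_
      rw [dualCode_dualCode] at hbC
      have := hd b hbC (by simpa using hab)
      omega
    · refine inner_cosetState_eq_zero_of_notMem fun h => ?_
      have h' := dualCode_anti hle h
      have hx' := mem_dualCode_span_singleton.1 hx
      have hy' := mem_dualCode_span_singleton.1 hy
      rw [mem_dualCode_span_singleton, dotProduct_sub, dotProduct_add, hx', hy', add_zero,
        sub_zero] at h'
      exact one_dotProduct_ne_zero_of_hammingNorm_lt_two ha0 ha h'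
  · obtain ⟨b, hbC, hbd⟩ := hb
    have hinner : ∀ x, ⟪cosetState (dualCode C) x, errZ b (cosetState (dualCode C) x)⟫_ℂ =
        (-1) ^ (b ⬝ᵥ x).val * Nat.card (dualCode C) := fun x => by
      have := inner_cosetState_errZ_self (D := dualCode C) (b := b)
        (by rwa [dualCode_dualCode]) x
      rwa [errX_zero, LinearMap.id_apply] at this
    have h0 := hmem 0 (Submodule.zero_mem _)
    refine ⟨b, hbd, fun hp => ?_, fun hk => ?_⟩
    · have := hp _ h0 _ h0
      rw [hinner] at this
      simp [hne] at this
    · rintro ⟨c, hc⟩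
      have hb0 : b ≠ 0 := by
        rintro rfl; rw [hammingNorm_zero] at hbd; omega
      -- If the all-ones word had minimal weight, every nonzero codeword would have full weight,
      -- contradicting dimension at least two.
      have hb1 : b ≠ fun _ => 1 := by
        rintro rfl
        obtain ⟨c, hcC, hc0, hc1⟩ := hconst hk
        have hcd := hd c hcC hc0
        refine hc1 (eq_one_of_card_le_hammingNorm ?_)
        rw [← hbd] at hcd
        simpa [hammingNorm] using hcd
      -- `Z_b` has eigenvalue `1` on the state of `0` and `-1` on that of `e_i + e_j`, so no single
      -- `c` works.
      obtain ⟨i, j, -, hij⟩ := hpair b hb0 hb1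
      have e0 := hc _ h0 _ h0
      have hx := hmem _ (hC₂ i j)
      have e1 := hc _ hx _ hx
      rw [hinner, inner_cosetState_self] at e0 e1
      rw [ones_dotProduct_single_add_single, neg_one_pow_val_of_ne hij] at e1
      rw [dotProduct_zero, ZMod.val_zero, pow_zero] at e0
      have e2 := (mul_right_cancel₀ hne e0).trans (mul_right_cancel₀ hne e1).symm
      norm_num at e2
  · have hinner : ∀ a, ⟪cosetState (dualCode C) a, errX a (cosetState (dualCode C) 0)⟫_ℂ =
        Nat.card (dualCode C) := fun a => by
      have := inner_cosetState_errX_self (dualCode C) 0 a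
      rwa [errZ_zero, LinearMap.id_apply, add_zero] at this
    have h0 := hmem 0 (Submodule.zero_mem _)
    -- For `k ≥ 1` the pair is chosen with `e_i + e_j` outside `C^⊥`: the error then carries the
    -- state of `0` to an orthogonal state of the code. For `k = 0` any pair serves.
    obtain ⟨i, j, hij, hk⟩ : ∃ i j : ι, i ≠ j ∧ (1 ≤ Module.finrank (ZMod 2) C - 1 →
        (Pi.single i 1 + Pi.single j 1 : ι → ZMod 2) ∉ dualCode C) := by
      by_cases hk : 1 ≤ Module.finrank (ZMod 2) C - 1
      · obtain ⟨c, hcC, hc0, hc1⟩ := hconst hk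
        obtain ⟨i, j, hij, hc⟩ := hpair c hc0 hc1
        refine ⟨i, j, hij, fun _ h => hc ?_⟩
        rw [← ones_dotProduct_single_add_single]
        exact h c hcC
      · obtain ⟨i, j, hij⟩ := Fintype.one_lt_card_iff.1 (by omega : 1 < Fintype.card ι)
        exact ⟨i, j, hij, fun h => absurd h hk⟩
    refine ⟨_, hammingNorm_single_add_single hij, fun hp => ?_, fun hk1 => ?_⟩
    · exact hne ((hinner _).symm.trans (hp _ (hmem _ (hC₂ i j)) _ h0))
    · rintro ⟨c, hc⟩
      have e := hc _ (hmem _ (hC₂ i j)) _ h0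
      rw [hinner, inner_cosetState_of_notMem (fun h => hk hk1 ?_), mul_zero] at e
      · exact hne e
      · simpa using (dualCode C).neg_mem h

end CSSWithOnes

/-! ### Extending and puncturing. -/

section Modify

variable {ι : Type*} [Fintype ι]

theorem natCast_hammingNorm (c : ι → ZMod 2) : (hammingNorm c : ZMod 2) = ∑ i, c i := by
  rw [hammingNorm, Finset.card_filter, Nat.cast_sum]
  refine Finset.sum_congr rfl fun i _ => ?_
  generalize c i = x
  revert x
  decide

theorem hammingNorm_option (v : Option ι → ZMod 2) :
    hammingNorm v = (if v none ≠ 0 then 1 else 0) + hammingNorm fun i => v (some i) := by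
  simp only [hammingNorm, Finset.card_filter, Fintype.sum_option]

/-- Extending a code with an odd weight minimal codeword and the all-ones vector of odd length. -/
theorem isPureAQC_extendCode [DecidableEq ι] {C : Submodule (ZMod 2) (ι → ZMod 2)} {n d : ℕ}
    (h1 : (fun _ => 1) ∈ C) (hcard : Fintype.card ι = n) (hn : Odd n) (hodd : Odd d)
    (hd : ∀ c ∈ C, c ≠ 0 → d ≤ hammingNorm c) (hb : ∃ b ∈ C, hammingNorm b = d) :
    ∃ k, Module.finrank (ZMod 2) C - 1 ≤ k ∧
      IsPureAQC (cssWithOnes (extendCode C)) (n + 1) k (d + 1) 2 := by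
  have hext : ∀ c ∈ C, (fun o : Option ι => o.elim (∑ i, c i) c) ∈ extendCode C := fun c hc => by
    refine ⟨hc, ?_⟩
    rw [Fintype.sum_option]
    exact CharTwo.add_self_eq_zero _
  have hwt : ∀ v ∈ extendCode C, v none = (hammingNorm fun i => v (some i) : ℕ) := fun v hv => by
    have := hv.2
    rw [Fintype.sum_option, CharTwo.add_eq_zero] at this
    rw [this, natCast_hammingNorm]
  have hle : Module.finrank (ZMod 2) C ≤ Module.finrank (ZMod 2) (extendCode C) := by
    have : C ≤ (extendCode C).map (LinearMap.funLeft (ZMod 2) (ZMod 2) some) := fun c hc =>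
      ⟨_, hext c hc, rfl⟩
    exact (Submodule.finrank_mono this).trans (Submodule.finrank_map_le _ _)
  refine ⟨_, Nat.sub_le_sub_right hle 1, isPureAQC_cssWithOnes ⟨h1, ?_⟩ ?_ ?_ ?_ ?_ ?_⟩
  · have hn' := hn.natCast_zmod_two
    simp [hcard, hn', CharTwo.add_self_eq_zero]
  · rw [Fintype.card_option, hcard]
  · obtain ⟨k, rfl⟩ := hn; omega
  · omega
  · intro v hv hv0
    have hv1 : (fun i => v (some i)) ≠ 0 := fun h => hv0 <| by
      funext o
      cases o with
      | none => rw [hwt v hv, h, hammingNorm_zero]; rfl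
      | some i => exact congrFun h i
    have h2 := hd _ hv.1 hv1
    rw [hammingNorm_option]
    rcases h2.lt_or_eq with h2 | h2
    · omega
    · have h3 : v none ≠ 0 := by
        rw [hwt v hv, ← h2, hodd.natCast_zmod_two]; exact one_ne_zero
      rw [if_pos h3, ← h2, add_comm]
  · obtain ⟨b, hbC, rfl⟩ := hb
    refine ⟨_, hext b hbC, ?_⟩
    rw [hammingNorm_option]
    have : (∑ i, b i) ≠ 0 := by
      rw [← natCast_hammingNorm, hodd.natCast_zmod_two]; exact one_ne_zero
    exact (congrArg (· + hammingNorm b) (if_pos this)).trans (add_comm _ _)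

variable [DecidableEq ι]

theorem hammingNorm_eq_add_punctured (c : ι → ZMod 2) (p : ι) :
    hammingNorm c = (if c p ≠ 0 then 1 else 0) +
      hammingNorm (fun i : {i : ι // i ≠ p} => c i) := by
  simp only [hammingNorm, Finset.card_filter]
  rw [← Finset.add_sum_erase _ _ (Finset.mem_univ p)]
  congr 1
  exact Finset.sum_subtype _ (fun x => by simp) _

/-- Puncturing a code at a coordinate in the support of a minimal weight codeword. -/
theorem isPureAQC_punctureCode {C : Submodule (ZMod 2) (ι → ZMod 2)} {n d : ℕ} (p : ι)
    (h1 : ∃ u ∈ C, ∀ i, i ≠ p → u i = 1) (hcard : Fintype.card ι = n) (hn : 3 ≤ n) (hd0 : 0 < d)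
    (hd : ∀ c ∈ C, c ≠ 0 → d + 1 ≤ hammingNorm c)
    (hb : ∃ b ∈ C, b p ≠ 0 ∧ hammingNorm b = d + 1) :
    IsPureAQC (cssWithOnes (punctureCode C p)) (n - 1) (Module.finrank (ZMod 2) C - 1) d 2 := by
  have hrank : Module.finrank (ZMod 2) (punctureCode C p) = Module.finrank (ZMod 2) C := by
    rw [punctureCode, ← LinearMap.range_domRestrict]
    -- A word killed by puncturing has weight at most one, below `d + 1`, so the dimension is kept.
    refine LinearMap.finrank_range_of_inj ((injective_iff_map_eq_zero _).2 fun c hc => ?_)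
    by_contra hne
    have h := hd c c.2 fun h => hne (Subtype.ext h)
    rw [hammingNorm_eq_add_punctured _ p] at h
    have h0 : (fun i : {i : ι // i ≠ p} => (c : ι → ZMod 2) i) = 0 := hc
    rw [h0, hammingNorm_zero] at h
    split_ifs at h <;> omega
  rw [← hrank]
  refine isPureAQC_cssWithOnes ?_ ?_ (by omega) hd0 ?_ ?_
  · obtain ⟨u, hu, hu1⟩ := h1
    exact ⟨u, hu, funext fun i => hu1 i i.2⟩
  · rw [Fintype.card_subtype_compl, hcard, Fintype.card_subtype_eq]
  · rintro _ ⟨c, hc, rfl⟩ hne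
    have h := hd c hc (by rintro rfl; exact hne (map_zero _))
    rw [hammingNorm_eq_add_punctured _ p] at h
    change d ≤ hammingNorm fun i : {i : ι // i ≠ p} => c i
    split_ifs at h <;> omega
  · obtain ⟨b, hbC, hbp, hb⟩ := hb
    refine ⟨_, ⟨b, hbC, rfl⟩, ?_⟩
    rw [hammingNorm_eq_add_punctured _ p, if_pos hbp] at hb
    change hammingNorm (fun i : {i : ι // i ≠ p} => b i) = d
    omega

end Modify

/-! ### Goppa codes with split separable polynomial: parity checks, dimension, distance. -/

section Goppa

variable {K F ι : Type*} [Field K] [Field F] [Algebra K F] [Fintype ι] {G : F[X]} {a : ι → F}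

/-- Division of `G` by `X - x` leaves the remainder `G(x)`; modulo `G`, `X - x` times the quotient
is thus the unit `-G(x)`. -/
theorem AdjoinRoot.isUnit_mk_X_sub_C {x : F} (hx : G.eval x ≠ 0) :
    IsUnit (AdjoinRoot.mk G (X - C x)) := by
  have h : G = (X - C x) * (G /ₘ (X - C x)) + C (G.eval x) := by
    rw [← modByMonic_X_sub_C_eq_C_eval, add_comm]
    exact (modByMonic_add_div G (X - C x)).symm
  have h2 := congrArg (AdjoinRoot.mk G) h
  rw [AdjoinRoot.mk_self, map_add, map_mul, AdjoinRoot.mk_C] at h2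
  refine isUnit_of_mul_isUnit_left (y := AdjoinRoot.mk G (G /ₘ (X - C x))) ?_
  rw [eq_neg_of_add_eq_zero_left h2.symm]
  exact ((IsUnit.mk0 _ hx).map (AdjoinRoot.of G)).neg

/-- Membership in a Goppa code whose Goppa polynomial has distinct roots in `F`. -/
theorem mem_goppaCode_iff (hs : G.Splits) (hsep : G.Separable) (ha : ∀ i, G.eval (a i) ≠ 0)
    {c : ι → K} : c ∈ goppaCode K G a ↔
      ∀ r, G.eval r = 0 → ∑ i, algebraMap K F (c i) * (r - a i)⁻¹ = 0 := by
  obtain ⟨p, hp⟩ := AdjoinRoot.mk_surjective (∑ i, AdjoinRoot.of G (algebraMap K F (c i)) *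
      Ring.inverse (AdjoinRoot.mk G (X - C (a i))))
  -- Evaluation at a root `r` factors through `F[z]/(G)` and turns each inverse into `(r - a i)⁻¹`.
  have hev : ∀ r, G.eval r = 0 → p.eval r = ∑ i, algebraMap K F (c i) * (r - a i)⁻¹ := by
    intro r hr
    have hr' : G.eval₂ (RingHom.id F) r = 0 := hr
    have := congrArg (AdjoinRoot.lift (RingHom.id F) r hr') hp
    rw [AdjoinRoot.lift_mk, map_sum] at this
    refine this.trans (Finset.sum_congr rfl fun i _ => ?_)
    rw [map_mul, AdjoinRoot.lift_of, RingHom.id_apply]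
    congr 1
    have h1 := congrArg (AdjoinRoot.lift (RingHom.id F) r hr')
      (Ring.inverse_mul_cancel _ (AdjoinRoot.isUnit_mk_X_sub_C (ha i)))
    rw [map_mul, map_one, AdjoinRoot.lift_mk] at h1
    refine eq_inv_of_mul_eq_one_left ?_
    simpa using h1
  change _ = _ ↔ _
  rw [← hp, AdjoinRoot.mk_eq_zero]
  constructor
  · intro h r hr
    rw [← hev r hr]
    exact eval_eq_zero_of_dvd_of_eval_eq_zero h hr
  · intro h
    by_cases hp0 : p = 0
    · rw [hp0]; exact dvd_zero _
    rw [hs.dvd_iff_roots_le_roots hsep.ne_zero hp0,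
      Multiset.le_iff_subset (nodup_roots hsep)]
    intro r hr
    have hr' := (mem_roots'.1 hr).2
    rw [mem_roots hp0, IsRoot, hev r hr']
    exact h r hr'

/-- Each of the `deg G` roots imposes one check with values in `F`, costing at most `[F : K]`
dimensions. -/
theorem finrank_goppaCode_le [FiniteDimensional K F] (hs : G.Splits) (hsep : G.Separable)
    (ha : ∀ i, G.eval (a i) ≠ 0) :
    Fintype.card ι ≤ Module.finrank K (goppaCode K G a) + G.natDegree * Module.finrank K F := by
  classical
  let φ : (ι → K) →ₗ[K] (G.roots.toFinset → F) :=
    { toFun := fun c r => ∑ i, algebraMap K F (c i) * ((r : F) - a i)⁻¹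
      map_add' := fun c d => by
        funext r
        simp [add_mul, Finset.sum_add_distrib]
      map_smul' := fun s c => by
        funext r
        simp [Algebra.smul_def, mul_assoc, Finset.mul_sum] }
  have hker : LinearMap.ker φ = goppaCode K G a := by
    ext c
    rw [mem_goppaCode_iff hs hsep ha, LinearMap.mem_ker, funext_iff]
    constructor
    · intro h r hr
      exact h ⟨r, Multiset.mem_toFinset.2 ((mem_roots hsep.ne_zero).2 hr)⟩
    · rintro h ⟨r, hr⟩
      exact h r (mem_roots'.1 (Multiset.mem_toFinset.1 hr)).2
  have h1 := φ.finrank_range_add_finrank_ker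
  have h2 := Submodule.finrank_le (LinearMap.range φ)
  rw [Module.finrank_pi_fintype, Finset.sum_const, Finset.card_univ, Fintype.card_coe,
    Multiset.toFinset_card_of_nodup (nodup_roots hsep), ← hs.natDegree_eq_card_roots,
    smul_eq_mul] at h2
  rw [hker, Module.finrank_fintype_fun_eq_card] at h1
  omega

theorem sum_inv_sub_eq_derivative_div {T : Finset F} {r : F} (hr : r ∉ T) :
    ∑ x ∈ T, (r - x)⁻¹ =
      (∏ x ∈ T, (X - C x)).derivative.eval r / (∏ x ∈ T, (X - C x)).eval r := by
  have hs : (∏ x ∈ T, (X - C x)).Splits := Splits.prod fun _ _ => Splits.X_sub_C _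
  rw [hs.eval_derivative_div_eval_of_ne_zero, roots_prod_X_sub_C]
  · simp only [one_div]; rfl
  · rw [eval_prod, Finset.prod_ne_zero_iff]
    intro x hx
    rw [eval_sub, eval_X, eval_C, sub_ne_zero]
    rintro rfl
    exact hr hx

/-- The second derivative is `2!` times the second Hasse derivative. -/
theorem derivative_derivative_eq_zero [CharP F 2] (f : F[X]) : derivative (derivative f) = 0 := by
  have h : (Nat.factorial 2 • @hasseDeriv F _ 2) f = derivative^[2] f :=
    congrFun (factorial_smul_hasseDeriv (R := F) (k := 2)) f
  have h2 : derivative^[2] f = 0 := by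
    rw [← h]
    ext n
    simp [CharTwo.two_eq_zero]
  simpa using h2

/-- The designed distance of a binary Goppa code with separable Goppa polynomial. -/
theorem two_mul_card_lt_card [CharP F 2] {T R : Finset F} (hdisj : ∀ r ∈ R, r ∉ T)
    (hT : T.Nonempty) (h : ∀ r ∈ R, ∑ x ∈ T, (r - x)⁻¹ = 0) : 2 * R.card + 1 ≤ T.card := by
  classical
  set f : F[X] := ∏ x ∈ T, (X - C x) with hf
  have hf0 : ∀ x, x ∉ T → f.eval x ≠ 0 := fun x hx => by
    rw [hf, eval_prod, Finset.prod_ne_zero_iff]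
    intro y hy
    rw [eval_sub, eval_X, eval_C, sub_ne_zero]
    rintro rfl
    exact hx hy
  have hsep : f.Separable := separable_prod_X_sub_C_iff'.2 fun x _ y _ h => h
  have hfd : f.natDegree = T.card := natDegree_finsetProd_X_sub_C_eq_card T id
  have hder : f.derivative ≠ 0 := fun h0 => by
    obtain ⟨x, hx⟩ := hT
    rw [Separable, h0, isCoprime_zero_right] at hsep
    have := natDegree_eq_zero_of_isUnit hsep
    rw [hfd, Finset.card_eq_zero] at this
    exact Finset.notMem_empty x (this ▸ hx)
  -- Each `r ∈ R` is a root of `f'` and of `f'' = 0`, hence at least a double root of `f'`.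
  have hmul : 2 • R.val ≤ f.derivative.roots := by
    rw [Multiset.le_iff_count]
    intro r
    rw [Multiset.count_nsmul]
    by_cases hr : r ∈ R
    · rw [count_roots, Multiset.count_eq_one_of_mem R.nodup hr]
      refine (one_lt_rootMultiplicity_iff_isRoot hder).2 ⟨?_, ?_⟩
      · have := h r hr
        rw [sum_inv_sub_eq_derivative_div (hdisj r hr), div_eq_zero_iff] at this
        exact this.resolve_right (hf0 r (hdisj r hr))
      · rw [derivative_derivative_eq_zero]; exact eval_zero
    · rw [Multiset.count_eq_zero_of_notMem hr]; omega
  have h1 := Multiset.card_le_card hmul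
  rw [Multiset.card_nsmul, Finset.card_val] at h1
  have h2 := h1.trans (card_roots' _)
  have h3 : f.natDegree ≠ 0 := by rw [hfd]; exact hT.card_pos.ne'
  have h4 := natDegree_derivative_lt h3
  omega

end Goppa

/-! ### Fibres of the `t`-th power map and their sums of inverses. -/

/-- The solutions of `x ^ t = B` in a finite field. -/
def powFiber {F : Type*} [Field F] [Fintype F] [DecidableEq F] (t : ℕ) (B : F) : Finset F :=
  Finset.univ.filter fun x => x ^ t = B

theorem mem_powFiber {F : Type*} [Field F] [Fintype F] [DecidableEq F] {t : ℕ} {B x : F} :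
    x ∈ powFiber t B ↔ x ^ t = B := by
  simp [powFiber]

section Fibers

variable {F : Type*} [Field F] [Fintype F] [DecidableEq F] [CharP F 2]

theorem natCast_eq_one_of_odd {R : Type*} [Ring R] [CharP R 2] {t : ℕ} (ht : Odd t) :
    (t : R) = 1 := by
  rw [CharTwo.natCast_eq_ite, if_neg (Nat.not_even_iff_odd.2 ht)]

theorem separable_X_pow_sub_C_of_odd {R : Type*} [Field R] [CharP R 2] {t : ℕ} (ht : Odd t)
    {B : R} (hB : B ≠ 0) : (X ^ t - C B : R[X]).Separable :=
  separable_X_pow_sub_C B (by rw [natCast_eq_one_of_odd ht]; exact one_ne_zero) hB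

variable {t : ℕ} {ζ b : F}

theorem powFiber_val (ht : Odd t) (hb : b ≠ 0) :
    (powFiber t (b ^ t)).val = (X ^ t - C (b ^ t) : F[X]).roots := by
  have hsep := separable_X_pow_sub_C_of_odd ht (pow_ne_zero t hb)
  refine (Multiset.Nodup.ext (Finset.nodup _) (nodup_roots hsep)).2 fun x => ?_
  rw [Finset.mem_val, mem_powFiber, mem_roots hsep.ne_zero]
  simp [sub_eq_zero]

theorem card_powFiber (hζ : IsPrimitiveRoot ζ t) (ht : Odd t) (hb : b ≠ 0) :
    (powFiber t (b ^ t)).card = t := by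
  rw [← Finset.card_val, powFiber_val ht hb,
    ← (X_pow_sub_C_splits_of_isPrimitiveRoot hζ rfl).natDegree_eq_card_roots,
    natDegree_X_pow_sub_C]

/-- Logarithmic derivative of `X^t - b^t` at `r`, with `t = 1` in `F`. -/
theorem sum_inv_sub_powFiber (hζ : IsPrimitiveRoot ζ t) (ht : Odd t) (hb : b ≠ 0) {r : F}
    (hr0 : r ≠ 0) (hr : r ^ t ≠ b ^ t) :
    ∑ x ∈ powFiber t (b ^ t), (r - x)⁻¹ = r⁻¹ * (r ^ t / (r ^ t + b ^ t)) := by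
  have hs := X_pow_sub_C_splits_of_isPrimitiveRoot hζ (rfl : b ^ t = b ^ t)
  have h := hs.eval_derivative_div_eval_of_ne_zero (x := r) (by simpa [sub_eq_zero] using hr)
  rw [← powFiber_val ht hb] at h
  have h2 : ∑ x ∈ powFiber t (b ^ t), (r - x)⁻¹ = ∑ x ∈ powFiber t (b ^ t), 1 / (r - x) := by
    simp only [one_div]
  refine h2.trans (h.symm.trans ?_)
  have h3 : r ^ (t - 1) = r⁻¹ * r ^ t := by
    rw [eq_inv_mul_iff_mul_eq₀ hr0, mul_comm, pow_sub_one_mul ht.pos.ne']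
  rw [derivative_sub, derivative_X_pow, derivative_C, natCast_eq_one_of_odd ht]
  simp [h3, CharTwo.sub_eq_add, mul_div_assoc]

/-- At roots of `G` the dependence on `r` is only the factor `r⁻¹`, so for unions of such fibres all
parity checks reduce to one scalar equation. -/
theorem sum_inv_sub_powFiber_mul (hζ : IsPrimitiveRoot ζ t) (ht : Odd t) (hb : b ≠ 0) {r ξ : F}
    (hr : r ^ t = b ^ t) (hξ0 : ξ ≠ 0) (hξ : ξ ^ t ≠ 1) :
    ∑ x ∈ powFiber t (b ^ t * ξ ^ t), (r - x)⁻¹ = r⁻¹ * (1 / (ξ ^ t + 1)) := by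
  have hbt : b ^ t ≠ 0 := pow_ne_zero t hb
  have hr0 : r ≠ 0 := by
    rintro rfl
    rw [zero_pow ht.pos.ne'] at hr
    exact hbt hr.symm
  rw [← mul_pow, sum_inv_sub_powFiber hζ ht (mul_ne_zero hb hξ0) hr0, hr, mul_pow]
  · congr 1
    have h : ξ ^ t + 1 ≠ 0 := by rwa [Ne, CharTwo.add_eq_zero]
    have h2 : b ^ t + b ^ t * ξ ^ t = b ^ t * (ξ ^ t + 1) := by ring
    rw [h2]
    field_simp
  · rw [hr, mul_pow]
    intro h
    exact hξ (mul_left_cancel₀ hbt (by rw [← h, mul_one]))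

end Fibers

/-! ### The sum `S` is idempotent. -/

section RootsOfUnitySum

variable {F : Type*} [Field F] [DecidableEq F] [CharP F 2]

/-- Squaring permutes the nontrivial roots of unity of odd order. -/
theorem sum_inv_pow_add_one_eq_zero_or_one {β : F} {l : ℕ} (hβ : IsPrimitiveRoot β l)
    (hl : Odd l) : let S := ∑ μ ∈ Finset.Ico 1 l, 1 / (β ^ μ + 1); S = 1 ∨ S = 0 := by
  intro S
  set Z : Finset F := (Finset.Ico 1 l).image fun μ => β ^ μ with hZ
  have hinj : Set.InjOn (fun μ => β ^ μ) (Finset.Ico 1 l : Set ℕ) := fun i hi j hj h =>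
    hβ.pow_inj (Finset.mem_Ico.1 hi).2 (Finset.mem_Ico.1 hj).2 h
  have hS : S = ∑ z ∈ Z, 1 / (z + 1) := by
    rw [hZ, Finset.sum_image hinj]
  have : NeZero l := ⟨hl.pos.ne'⟩
  have hmem : ∀ z, z ∈ Z ↔ z ^ l = 1 ∧ z ≠ 1 := by
    intro z
    rw [hZ, Finset.mem_image]
    constructor
    · rintro ⟨μ, hμ, rfl⟩
      rw [Finset.mem_Ico] at hμ
      refine ⟨by rw [← pow_mul, mul_comm, pow_mul, hβ.pow_eq_one, one_pow], ?_⟩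
      exact hβ.pow_ne_one_of_pos_of_lt (by omega) hμ.2
    · rintro ⟨h1, h2⟩
      obtain ⟨i, hi, rfl⟩ := hβ.eq_pow_of_pow_eq_one h1
      refine ⟨i, Finset.mem_Ico.2 ⟨?_, hi⟩, rfl⟩
      by_contra h
      have : i = 0 := by omega
      exact h2 (by rw [this, pow_zero])
  have hsub : Z.image (fun z => z ^ 2) = Z := by
    refine Finset.eq_of_subset_of_card_le ?_
      (Finset.card_image_of_injective Z CharTwo.sq_injective).ge
    intro w hw
    obtain ⟨z, hz, rfl⟩ := Finset.mem_image.1 hw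
    rw [hmem] at hz ⊢
    refine ⟨by rw [← pow_mul, mul_comm, pow_mul, hz.1, one_pow], fun h => hz.2 ?_⟩
    exact CharTwo.sq_injective (by simpa using h)
  -- Frobenius sends `1/(z + 1)` to `1/(z² + 1)`, so squaring `S` only permutes its terms.
  have hsq : S ^ 2 = S := by
    rw [hS, CharTwo.sum_sq]
    conv_rhs => rw [← hsub, Finset.sum_image CharTwo.sq_injective.injOn]
    refine Finset.sum_congr rfl fun z _ => ?_
    rw [div_pow, one_pow, CharTwo.add_sq, one_pow]
  have : S * (S - 1) = 0 := by rw [mul_sub, mul_one, ← sq, hsq, sub_self]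
  rcases mul_eq_zero.1 this with h | h
  · exact Or.inr h
  · exact Or.inl (sub_eq_zero.1 h)

end RootsOfUnitySum

/-! ### Binary words as subsets of the field. -/

section IndicatorWord

variable {F : Type*} [Field F] [Fintype F] [DecidableEq F]

/-- The word on the location set `NonRoots G` with support `T`. -/
def indicatorWord (G : F[X]) (T : Finset F) : NonRoots G → ZMod 2 :=
  fun x => if (x : F) ∈ T then 1 else 0

theorem sum_nonRoots_ite {M : Type*} [AddCommMonoid M] {G : F[X]} {T : Finset F}
    (hT : ∀ x ∈ T, G.eval x ≠ 0) (f : F → M) :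
    ∑ x : NonRoots G, (if (x : F) ∈ T then f x else 0) = ∑ x ∈ T, f x := by
  rw [← Finset.sum_subtype (Finset.univ.filter fun x => G.eval x ≠ 0) (by simp)
    (fun x => if x ∈ T then f x else 0), Finset.sum_ite_mem]
  congr 1
  ext x
  simp only [Finset.mem_inter, Finset.mem_filter, Finset.mem_univ, true_and,
    and_iff_right_iff_imp]
  exact hT x

theorem hammingNorm_indicatorWord {G : F[X]} {T : Finset F} (hT : ∀ x ∈ T, G.eval x ≠ 0) :
    hammingNorm (indicatorWord G T) = T.card := by
  rw [hammingNorm, Finset.card_filter, Finset.card_eq_sum_ones, ← sum_nonRoots_ite hT]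
  refine Finset.sum_congr rfl fun x _ => ?_
  by_cases h : (x : F) ∈ T <;> simp [indicatorWord, h]

theorem exists_eq_indicatorWord {G : F[X]} (c : NonRoots G → ZMod 2) :
    ∃ T : Finset F, (∀ x ∈ T, G.eval x ≠ 0) ∧ c = indicatorWord G T := by
  refine ⟨(Finset.univ.filter fun x => c x ≠ 0).map (Function.Embedding.subtype _), ?_, ?_⟩
  · intro x hx
    obtain ⟨y, -, rfl⟩ := Finset.mem_map.1 hx
    exact y.2
  · funext x
    by_cases h : c x = 0
    · simp [indicatorWord, h]
    · simp [indicatorWord, x.2, zmod_two_ne_zero h]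

variable [Algebra (ZMod 2) F]

theorem indicatorWord_mem_goppaCode_iff {G : F[X]} (hs : G.Splits) (hsep : G.Separable)
    {T : Finset F} (hT : ∀ x ∈ T, G.eval x ≠ 0) :
    indicatorWord G T ∈ goppaCode (ZMod 2) G (fun x : NonRoots G => (x : F)) ↔
      ∀ r, G.eval r = 0 → ∑ x ∈ T, (r - x)⁻¹ = 0 := by
  rw [mem_goppaCode_iff hs hsep fun x => x.2]
  refine forall₂_congr fun r _ => ?_
  rw [← sum_nonRoots_ite hT]
  refine Eq.congr_left (Finset.sum_congr rfl fun x _ => ?_)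
  by_cases h : (x : F) ∈ T <;> simp [indicatorWord, h]

theorem le_hammingNorm_of_mem_goppaCode [CharP F 2] {G : F[X]} (hs : G.Splits)
    (hsep : G.Separable) {c : NonRoots G → ZMod 2}
    (hc : c ∈ goppaCode (ZMod 2) G (fun x : NonRoots G => (x : F))) (hc0 : c ≠ 0) :
    2 * G.natDegree + 1 ≤ hammingNorm c := by
  obtain ⟨T, hT, rfl⟩ := exists_eq_indicatorWord c
  rw [indicatorWord_mem_goppaCode_iff hs hsep hT] at hc
  rw [hammingNorm_indicatorWord hT, hs.natDegree_eq_card_roots,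
    ← Multiset.toFinset_card_of_nodup (nodup_roots hsep)]
  refine two_mul_card_lt_card (fun r hr hrT => ?_) ?_ fun r hr => ?_
  · exact hT r hrT (mem_roots'.1 (Multiset.mem_toFinset.1 hr)).2
  · rw [Finset.nonempty_iff_ne_empty]
    rintro rfl
    exact hc0 (funext fun x => if_neg (Finset.notMem_empty _))
  · exact hc r (mem_roots'.1 (Multiset.mem_toFinset.1 hr)).2

end IndicatorWord

/-! ### Explicit supports of codewords. -/

section Supports

variable {F : Type*} [Field F] [Fintype F] [DecidableEq F] [CharP F 2] {t : ℕ} {ζ a : F}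

/-- The support of a minimum weight codeword of the Goppa code with polynomial `X ^ t + a ^ t`:
zero and two cosets of the group of `t`-th roots of unity. -/
theorem exists_support_card_eq (hζ : IsPrimitiveRoot ζ t) (ht : Odd t) (ha : a ≠ 0) {ξ : F}
    (hξ0 : ξ ≠ 0) (hξ : ξ ^ t ≠ 1) :
    ∃ T : Finset F, (∀ x ∈ T, x ^ t ≠ a ^ t) ∧ 0 ∈ T ∧ a * ξ ∈ T ∧ T.card = 2 * t + 1 ∧
      ∀ r, r ^ t = a ^ t → ∑ x ∈ T, (r - x)⁻¹ = 0 := by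
  have hat : a ^ t ≠ 0 := pow_ne_zero t ha
  have hξt : ξ ^ t ≠ 0 := pow_ne_zero t hξ0
  have hi0 : ξ⁻¹ ≠ 0 := inv_ne_zero hξ0
  have hi : ξ⁻¹ ^ t ≠ 1 := by rwa [inv_pow, Ne, inv_eq_one]
  -- Equality would give `(ξ^t)² = 1`, hence `ξ^t = 1` in characteristic two; so the two fibres are
  -- disjoint.
  have hne : ξ ^ t ≠ ξ⁻¹ ^ t := fun h => by
    rw [inv_pow] at h
    have h2 : (ξ ^ t) ^ 2 = 1 := by
      nth_rewrite 1 [sq, h]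
      exact inv_mul_cancel₀ hξt
    exact hξ (CharTwo.sq_injective (by simpa using h2))
  have h0 : ∀ η : F, η ≠ 0 → (0 : F) ∉ powFiber t (a ^ t * η ^ t) := fun η hη h => by
    rw [mem_powFiber, zero_pow ht.pos.ne', ← mul_pow] at h
    exact pow_ne_zero t (mul_ne_zero ha hη) h.symm
  have hdisj : Disjoint (powFiber t (a ^ t * ξ ^ t)) (powFiber t (a ^ t * ξ⁻¹ ^ t)) := by
    rw [Finset.disjoint_left]
    intro x h1 h2
    rw [mem_powFiber] at h1 h2
    exact hne (mul_left_cancel₀ hat (h1.symm.trans h2))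
  have h0' : (0 : F) ∉ powFiber t (a ^ t * ξ ^ t) ∪ powFiber t (a ^ t * ξ⁻¹ ^ t) := by
    rw [Finset.mem_union, not_or]
    exact ⟨h0 _ hξ0, h0 _ hi0⟩
  have hmul : ∀ η : F, η ^ t ≠ 1 → a ^ t * η ^ t ≠ a ^ t := fun η hη h =>
    hη (mul_left_cancel₀ hat (by rw [h, mul_one]))
  refine ⟨insert 0 (powFiber t (a ^ t * ξ ^ t) ∪ powFiber t (a ^ t * ξ⁻¹ ^ t)), ?_,
    Finset.mem_insert_self _ _, ?_, ?_, ?_⟩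
  · intro x hx
    rw [Finset.mem_insert, Finset.mem_union, mem_powFiber, mem_powFiber] at hx
    rcases hx with rfl | hx | hx
    · rw [zero_pow ht.pos.ne']; exact hat.symm
    · rw [hx]; exact hmul _ hξ
    · rw [hx]; exact hmul _ hi
  · refine Finset.mem_insert_of_mem (Finset.mem_union_left _ ?_)
    rw [mem_powFiber, mul_pow]
  · rw [Finset.card_insert_of_notMem h0', Finset.card_union_of_disjoint hdisj, ← mul_pow,
      ← mul_pow, card_powFiber hζ ht (mul_ne_zero ha hξ0), card_powFiber hζ ht (mul_ne_zero ha hi0)]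
    ring
  · intro r hr
    rw [Finset.sum_insert h0', Finset.sum_union hdisj, sum_inv_sub_powFiber_mul hζ ht ha hr hξ0 hξ,
      sum_inv_sub_powFiber_mul hζ ht ha hr hi0 hi, sub_zero, ← mul_add]
    have h1 : ξ ^ t + 1 ≠ 0 := by rwa [Ne, CharTwo.add_eq_zero]
    -- The two fibres together contribute `r⁻¹`, cancelling the term of `x = 0`.
    have h2 : 1 / (ξ ^ t + 1) + 1 / (ξ⁻¹ ^ t + 1) = 1 := by
      rw [inv_pow]
      have h3 : (ξ ^ t)⁻¹ + 1 = (ξ ^ t + 1) * (ξ ^ t)⁻¹ := by field_simp; ring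
      rw [h3]
      field_simp
      ring
    rw [h2, mul_one, CharTwo.add_self_eq_zero]

/-- The sum over all nonzero locations. -/
theorem sum_inv_sub_nonzero_locations (hζ : IsPrimitiveRoot ζ t) (ht : Odd t) (ha : a ≠ 0)
    {α : F} {l : ℕ} (hα : IsPrimitiveRoot (α ^ t) l) (hcard : Fintype.card F - 1 = t * l) {r : F}
    (hr : r ^ t = a ^ t) (hl : 0 < l) :
    ∑ x ∈ Finset.univ.filter (fun x : F => x ≠ 0 ∧ x ^ t ≠ a ^ t), (r - x)⁻¹ =
      r⁻¹ * ∑ μ ∈ Finset.Ico 1 l, 1 / ((α ^ t) ^ μ + 1) := by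
  have hat : a ^ t ≠ 0 := pow_ne_zero t ha
  have : NeZero l := ⟨hl.ne'⟩
  have hα0 : α ≠ 0 := fun h => by
    have := hα.pow_eq_one
    rw [h, zero_pow ht.pos.ne', zero_pow hl.ne'] at this
    exact zero_ne_one this
  have hcomm : ∀ μ, (α ^ t) ^ μ = (α ^ μ) ^ t := fun μ => by rw [← pow_mul, ← pow_mul, mul_comm]
  have hne : ∀ μ ∈ Finset.Ico 1 l, (α ^ μ) ^ t ≠ 1 := fun μ hμ => by
    rw [Finset.mem_Ico] at hμ
    rw [← hcomm]
    exact hα.pow_ne_one_of_pos_of_lt (by omega) hμ.2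
  -- `(x/a)^t` is an `l`-th root of unity, so a power `(α^t)^μ`; the value `μ = 0` is the root set
  -- of `G`.
  have hunion : Finset.univ.filter (fun x : F => x ≠ 0 ∧ x ^ t ≠ a ^ t) =
      (Finset.Ico 1 l).biUnion fun μ => powFiber t (a ^ t * (α ^ μ) ^ t) := by
    ext x
    simp only [Finset.mem_filter, Finset.mem_univ, true_and, Finset.mem_biUnion, mem_powFiber]
    constructor
    · rintro ⟨hx0, hx⟩
      have h1 : ((x / a) ^ t) ^ l = 1 := by
        rw [← pow_mul, ← hcard]
        exact FiniteField.pow_card_sub_one_eq_one _ (div_ne_zero hx0 ha)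
      obtain ⟨μ, hμ, h2⟩ := hα.eq_pow_of_pow_eq_one h1
      have h3 : x ^ t = a ^ t * (α ^ μ) ^ t := by
        rw [← hcomm, h2, div_pow, mul_div_cancel₀ _ hat]
      refine ⟨μ, Finset.mem_Ico.2 ⟨?_, hμ⟩, h3⟩
      by_contra h
      have : μ = 0 := by omega
      subst this
      exact hx (by simpa using h3)
    · rintro ⟨μ, hμ, h⟩
      refine ⟨?_, ?_⟩
      · rintro rfl
        rw [zero_pow ht.pos.ne'] at h
        exact mul_ne_zero hat (pow_ne_zero _ (pow_ne_zero _ hα0)) h.symm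
      · rw [h]
        exact fun h' => hne μ hμ (mul_left_cancel₀ hat (by rw [h', mul_one]))
  rw [hunion, Finset.sum_biUnion, Finset.mul_sum]
  · refine Finset.sum_congr rfl fun μ hμ => ?_
    rw [sum_inv_sub_powFiber_mul hζ ht ha hr (pow_ne_zero _ hα0) (hne μ hμ), hcomm]
  · intro i hi j hj hij
    rw [Function.onFun, Finset.disjoint_left]
    intro x h1 h2
    rw [mem_powFiber] at h1 h2
    rw [h1, ← hcomm, ← hcomm] at h2
    exact hij (hα.pow_inj (Finset.mem_Ico.1 hi).2 (Finset.mem_Ico.1 hj).2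
      (mul_left_cancel₀ hat h2))

end Supports

/-! ### Assembly of the classical and quantum parameters. -/

theorem theorem4p4 {F : Type*} [Field F] [Fintype F] [DecidableEq F] [Algebra (ZMod 2) F]
    (m t l : ℕ) (hF : Fintype.card F = 2 ^ m) (htl : 2 ^ m - 1 = t * l)
    (A : F) (hA : ∃ a : F, a ≠ 0 ∧ a ^ t = A)
    (G : F[X]) (hG : G = X ^ t + C A)
    (α : F) (hα : IsPrimitiveRoot α (2 ^ m - 1))
    (S : F) (hS : S = ∑ μ ∈ Finset.Ico 1 l, 1 / (α ^ (μ * t) + 1)) :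
    (S = 1 ∨ S = 0) ∧
    (S = 1 →
      -- the all-ones vector is a codeword of `Γ(𝒩, G)`
      (fun _ => 1) ∈ goppaCode (ZMod 2) G (fun x : NonRoots G => (x : F)) ∧
      -- the quantum code from `Γ(𝒩, G)`
      (∃ k : ℕ, (2 : ℤ) ^ m - t - m * t - 1 ≤ k ∧
        IsPureAQC (cssWithOnes (goppaCode (ZMod 2) G (fun x : NonRoots G => (x : F))))
          (2 ^ m - t) k (2 * t + 1) 2) ∧
      -- the extended version
      (∃ k : ℕ, (2 : ℤ) ^ m - t - m * t - 1 ≤ k ∧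
        IsPureAQC (cssWithOnes (extendCode
            (goppaCode (ZMod 2) G (fun x : NonRoots G => (x : F)))))
          (2 ^ m - t + 1) k (2 * t + 2) 2) ∧
      -- the punctured version, for puncturing at any coordinate
      (∀ p : NonRoots G, ∃ k : ℕ, (2 : ℤ) ^ m - t - m * t - 1 ≤ k ∧
        IsPureAQC (cssWithOnes (punctureCode
            (goppaCode (ZMod 2) G (fun x : NonRoots G => (x : F))) p))
          (2 ^ m - t - 1) k (2 * t) 2)) ∧
    -- `l ≠ 1` says that the location set `𝒩 \ {0}` is nonempty
    (S = 0 → l ≠ 1 →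
      ∃ p : NonRoots G, (p : F) = 0 ∧
        ∃ k dz : ℕ, (2 : ℤ) ^ m - t - m * t - 1 ≤ k ∧ 2 * t ≤ dz ∧
          IsPureAQC (cssWithOnes (punctureCode
              (goppaCode (ZMod 2) G (fun x : NonRoots G => (x : F))) p))
            (2 ^ m - t - 1) k dz 2) := by
  obtain ⟨a, ha, rfl⟩ := hA
  have : CharP F 2 := charP_of_injective_algebraMap (algebraMap (ZMod 2) F).injective 2
  have hm : m ≠ 0 := by
    rintro rfl
    have := Fintype.one_lt_card (α := F)
    rw [hF, pow_zero] at this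
    exact lt_irrefl _ this
  have hpos : 0 < 2 ^ m := Nat.two_pow_pos m
  have hodd : Odd (t * l) := by
    rw [← htl]
    exact Nat.Even.sub_odd (by omega) ((Nat.even_pow' hm).2 even_two) odd_one
  obtain ⟨ht, hl⟩ := Nat.odd_mul.1 hodd
  have hpos' : 0 < 2 ^ m - 1 := by rw [htl]; exact hodd.pos
  have hβ : IsPrimitiveRoot (α ^ t) l := hα.pow hpos' htl
  have hζ : IsPrimitiveRoot (α ^ l) t := hα.pow hpos' (by rw [htl, mul_comm])
  have hcard : Fintype.card F - 1 = t * l := by rw [hF, htl]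
  have hα0 : α ≠ 0 := hα.ne_zero hpos'.ne'
  have hS' : S = ∑ μ ∈ Finset.Ico 1 l, 1 / ((α ^ t) ^ μ + 1) := by
    rw [hS]
    refine Finset.sum_congr rfl fun μ _ => ?_
    rw [← pow_mul, mul_comm]
  have hat : a ^ t ≠ 0 := pow_ne_zero t ha
  have hG' : G = X ^ t - C (a ^ t) := by
    rw [hG, sub_eq_add_neg, ← C_neg, CharTwo.neg_eq]
  have hs : G.Splits := hG' ▸ X_pow_sub_C_splits_of_isPrimitiveRoot hζ rfl
  have hsep : G.Separable := hG' ▸ separable_X_pow_sub_C_of_odd ht hat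
  have hdeg : G.natDegree = t := by rw [hG', natDegree_X_pow_sub_C]
  have hev : ∀ x, G.eval x = 0 ↔ x ^ t = a ^ t := fun x => by
    simp [hG', sub_eq_zero]
  have hev' : ∀ x, x ^ t ≠ a ^ t → G.eval x ≠ 0 := fun x h => mt (hev x).1 h
  have hN : Fintype.card (NonRoots G) = 2 ^ m - t := by
    rw [← hF, Fintype.card_subtype, ← card_powFiber hζ ht ha, ← Finset.card_compl]
    congr 1
    ext x
    simp [mem_powFiber, hev]
  have hfin : Module.finrank (ZMod 2) F = m := by
    have := Module.card_eq_pow_finrank (K := ZMod 2) (V := F)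
    rw [hF, ZMod.card] at this
    exact (Nat.pow_right_injective le_rfl this).symm
  set Γ := goppaCode (ZMod 2) G (fun x : NonRoots G => (x : F)) with hΓ
  have hdim : 2 ^ m - t ≤ Module.finrank (ZMod 2) Γ + t * m := by
    have := finrank_goppaCode_le (K := ZMod 2) (a := fun x : NonRoots G => (x : F)) hs hsep
      fun x => x.2
    rwa [hN, hdeg, hfin] at this
  -- The bound lives in `ℤ` because it can be negative.
  have hk : ∀ k, Module.finrank (ZMod 2) Γ - 1 ≤ k → (2 : ℤ) ^ m - t - m * t - 1 ≤ k := by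
    intro k hk
    have h1 : 2 ^ m ≤ k + 1 + t * m + t := by omega
    have h2 : (2 : ℤ) ^ m ≤ k + 1 + t * m + t := by exact_mod_cast h1
    linarith [mul_comm (t : ℤ) m]
  have hmin : ∀ c ∈ Γ, c ≠ 0 → 2 * t + 1 ≤ hammingNorm c := fun c hc hc0 => by
    simpa [hdeg] using le_hammingNorm_of_mem_goppaCode hs hsep hc hc0
  have hword : ∀ T : Finset F, (∀ x ∈ T, x ^ t ≠ a ^ t) →
      (indicatorWord G T ∈ Γ ↔ ∀ r, r ^ t = a ^ t → ∑ x ∈ T, (r - x)⁻¹ = 0) := fun T hT => by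
    rw [hΓ, indicatorWord_mem_goppaCode_iff hs hsep fun x hx => hev' x (hT x hx)]
    simp only [hev]
  have hsum : ∀ r, r ^ t = a ^ t →
      ∑ x ∈ Finset.univ.filter (fun x : F => x ≠ 0 ∧ x ^ t ≠ a ^ t), (r - x)⁻¹ = r⁻¹ * S :=
    fun r hr => by rw [sum_inv_sub_nonzero_locations hζ ht ha hβ hcard hr hl.pos, hS']
  -- As `l` is odd, `l ≥ 3`, so `2^m - t = tl + 1 - t ≥ 2t + 1`.
  have hbig : l ≠ 1 → 3 ≤ 2 ^ m - t := fun hl1 => by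
    obtain ⟨j, rfl⟩ := hl
    have h1 : t * 3 ≤ t * (2 * j + 1) := Nat.mul_le_mul_left t (by omega)
    have := ht.pos
    omega
  have hminimal : l ≠ 1 → ∀ p : NonRoots G, ∃ b ∈ Γ, b p ≠ 0 ∧ hammingNorm b = 2 * t + 1 := by
    intro hl1 p
    -- For `p ≠ 0` the choice `ξ = p/a` puts `p` in the support; `0` always lies there, so `ξ = α`
    -- serves for `p = 0`.
    obtain ⟨ξ, hξ0, hξ, hp⟩ : ∃ ξ : F, ξ ≠ 0 ∧ ξ ^ t ≠ 1 ∧ ((p : F) = 0 ∨ (p : F) = a * ξ) := by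
      by_cases hp : (p : F) = 0
      · have := hl.pos
        refine ⟨α, hα0, ?_, Or.inl hp⟩
        simpa using hβ.pow_ne_one_of_pos_of_lt one_ne_zero (by omega)
      · refine ⟨p / a, div_ne_zero hp ha, ?_, Or.inr (mul_div_cancel₀ _ ha).symm⟩
        rw [div_pow, Ne, div_eq_one_iff_eq hat, ← hev]
        exact p.2
    obtain ⟨T, hT, h0, h1, h2, h3⟩ := exists_support_card_eq hζ ht ha hξ0 hξ
    refine ⟨indicatorWord G T, (hword T hT).2 h3, ?_, ?_⟩
    · have : (p : F) ∈ T := by rcases hp with hp | hp <;> rwa [hp]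
      simp [indicatorWord, this]
    · rw [hammingNorm_indicatorWord fun x hx => hev' x (hT x hx), h2]
  refine ⟨hS' ▸ sum_inv_pow_add_one_eq_zero_or_one hβ hl, fun hS1 => ?_, fun hS0 hl1 => ?_⟩
  · have hl1 : l ≠ 1 := by
      rintro rfl
      rw [hS] at hS1
      simp at hS1
    have hone : (fun _ => 1) ∈ Γ := by
      have h := (hword (insert 0 (Finset.univ.filter fun x : F => x ≠ 0 ∧ x ^ t ≠ a ^ t)) ?_).2 ?_
      · convert h using 1
        funext x
        have hx := mt (hev x).2 x.2
        by_cases h0 : (x : F) = 0 <;> simp [indicatorWord, h0, hx]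
      · intro x hx
        rcases Finset.mem_insert.1 hx with rfl | hx
        · rw [zero_pow ht.pos.ne']; exact hat.symm
        · exact (Finset.mem_filter.1 hx).2.2
      · intro r hr
        rw [Finset.sum_insert (by simp), hsum r hr, hS1, sub_zero, mul_one,
          CharTwo.add_self_eq_zero]
    have hex : ∃ b ∈ Γ, hammingNorm b = 2 * t + 1 := by
      obtain ⟨b, hb, -, hw⟩ := hminimal hl1 ⟨0, hev' 0 (by
        rw [zero_pow ht.pos.ne']; exact hat.symm)⟩
      exact ⟨b, hb, hw⟩
    have := hbig hl1
    refine ⟨hone, ⟨_, hk _ le_rfl, isPureAQC_cssWithOnes hone hN (by omega) (by omega) hmin hex⟩,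
      ?_, fun p => ?_⟩
    · have hNodd : Odd (2 ^ m - t) :=
        Nat.Even.sub_odd (by omega) ((Nat.even_pow' hm).2 even_two) ht
      obtain ⟨k, hk1, hk2⟩ := isPureAQC_extendCode hone hN hNodd (odd_two_mul_add_one t) hmin hex
      exact ⟨k, hk k hk1, hk2⟩
    · exact ⟨_, hk _ le_rfl, isPureAQC_punctureCode p ⟨_, hone, fun _ _ => rfl⟩ hN this
        (by have := ht.pos; omega) hmin (hminimal hl1 p)⟩
  · have h0 : (0 : F) ^ t ≠ a ^ t := by rw [zero_pow ht.pos.ne']; exact hat.symm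
    -- The codeword equal to one exactly off `0` becomes all-ones after puncturing at `0`. A minimal
    -- word passes through `0`, so `dz = 2t` is attained.
    refine ⟨⟨0, hev' 0 h0⟩, rfl, _, 2 * t, hk _ le_rfl, le_rfl,
      isPureAQC_punctureCode _ ⟨_, (hword (Finset.univ.filter fun x : F => x ≠ 0 ∧ x ^ t ≠ a ^ t)
        fun x hx => (Finset.mem_filter.1 hx).2.2).2 fun r hr => ?_, fun x hx => ?_⟩ hN (hbig hl1)
        (by have := ht.pos; omega) hmin (hminimal hl1 _)⟩
    · rw [hsum r hr, hS0, mul_zero]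
    · have hx0 : (x : F) ≠ 0 := fun h => hx (Subtype.ext h)
      have hx1 := mt (hev x).2 x.2
      simp [indicatorWord, hx0, hx1]
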